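/- **Conventions.** All graphs are finite, simple and undirected; $\hom(F,G)$ is the number of homomorphisms from $F$ to $G$. $G$ and $H$ are *homomorphism indistinguishable* over a class $\mathcal F$ of graphs if $\hom(F,G)=\hom(F,H)$ for all $F\in\mathcal F$. **Logic.** Formulas of guarded counting logic $\mathsf{GC}$ are built from the atomic formulas $x=y$ and $Exy$ (over variables $x_1,x_2,\dots$) by $\neg,\wedge,\vee,\rightarrow$ and guarded counting quantifiers $\exists^{\ge t}y\,(Exy\wedge\psi)$, where $t\in\mathbb N$ and $x,y$ are distinct variables; the latter says that at least $t$ neighbours $y$ of $x$ satisfy $\psi$. $\mathsf{GC}^k_q$ is the set of $\mathsf{GC}$-formulas in which at most $k$ distinct variables occur and whose quantifier rank is at most $q$. Graphs $G,H$ are $\mathsf{GC}^k_q$-*equivalent* if there is a bijection $f\colon V(G)\to V(H)$ such that for all $v\in V(G)$ and all $\varphi\in\mathsf{GC}^k_q$ with no free variable other than $x$, $G,v\models\varphi(x)$ if and only if $H,f(v)\models\varphi(x)$. **Graph class.** A $k$-labelled graph is a graph $G$ with a partial function $\nu_G\colon\{1,\dots,k\}\rightharpoonup V(G)$. It is *fully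 labelled* if every vertex has at least one label. The *product* of $k$-labelled graphs is obtained from their disjoint union by identifying vertices with the same label and suppressing loops and parallel edges. A *$k$-construction tree* for $G$ is a finite rooted tree whose nodes are assigned $k$-labelled graphs such that the root is assigned $G$, the leaves are assigned fully labelled graphs, the graph at a node with exactly one child (an *elimination node*) is obtained from the graph at the child by removing one label, and the graph at a node with at least two children is the product of the graphs at its children (all up to isomorphism). Its *elimination depth* is the maximum number of elimination nodes on a path from the root to a leaf. It is *guarded* if at every elimination node the removed label sits, in the child's graph, on a vertex that has a labelled neighbour. Let $\mathcal{GL}^k_q$ be the class of $k$-labelled graphs that have a guarded $k$-construction tree of elimination depth at most $q$, and let $\mathcal{GT}^k_q$ be the class of unlabelled graphs obtained by removing all labels from the graphs in $\mathcal{GL}^k_q$ that have exactly one labelled vertex. **Theorem.** Let $k,q\ge 1$. Two graphs $G$ and $H$ are $\mathsf{GC}^k_q$-equivalent if and only if they are homomorphism indistinguishable over $\mathcal{GT}^k_q$. -/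

import Mathlib

/-- A finite simple graph with a partial assignment of the labels `0, …, k - 1` to its vertices
(a vertex may carry several labels, a label is carried by at most one vertex). -/
structure LabelledGraph (k : ℕ) : Type 1 where
  V : Type
  finite : Finite V
  graph : SimpleGraph V
  lab : Fin k → Option V

namespace LabelledGraph

variable {k : ℕ}

/-- Every vertex carries at least one label. -/
def FullyLabelled (G : LabelledGraph k) : Prop :=
  ∀ v : G.V, ∃ l, G.lab l = some v

/-- Isomorphism of labelled graphs: a graph isomorphism that respects the labelling in both
directions (including which labels are unassigned). -/
def Isomorphic (G H : LabelledGraph k) : Prop :=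
  ∃ e : G.graph ≃g H.graph, ∀ l, H.lab l = (G.lab l).map e

/-- Remove the label `l`. -/
def remove (G : LabelledGraph k) (l : Fin k) : LabelledGraph k where
  V := G.V
  finite := G.finite
  graph := G.graph
  lab := Function.update G.lab l none

/-- The label `l` is assigned, and the vertex carrying it has a neighbour carrying a label. -/
def HasLabelledNeighbour (G : LabelledGraph k) (l : Fin k) : Prop :=
  ∃ v w m, G.lab l = some v ∧ G.lab m = some w ∧ G.graph.Adj v w

/-- Exactly one vertex carries a label. -/
def SingleLabelledVertex (G : LabelledGraph k) : Prop :=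
  ∃! v : G.V, ∃ l, G.lab l = some v

section Product

variable {n : ℕ} (F : Fin n → LabelledGraph k)

/-- Two vertices of the disjoint union carry a common label. -/
def Glue (x y : Σ i, (F i).V) : Prop :=
  ∃ l, (F x.1).lab l = some x.2 ∧ (F y.1).lab l = some y.2

open Classical in
/-- The product of labelled graphs: the disjoint union modulo the equivalence relation generated
by identifying vertices with the same label; loops and parallel edges are suppressed. -/
noncomputable def product : LabelledGraph k where
  V := Quot (Glue F)
  finite := by
    have := fun i => (F i).finite
    infer_instance
  graph := SimpleGraph.fromRel fun a b =>
    ∃ (i : Fin n) (u v : (F i).V), (F i).graph.Adj u v ∧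
      Quot.mk (Glue F) ⟨i, u⟩ = a ∧ Quot.mk (Glue F) ⟨i, v⟩ = b
  lab l :=
    if h : ∃ x : (Σ i, (F i).V), (F x.1).lab l = some x.2 then
      some (Quot.mk (Glue F) h.choose)
    else none

/-- The label `l` of the product sits on the class of any vertex that carries `l` in a factor. -/
theorem product_lab_of_eq_some {i : Fin n} {v : (F i).V} {l : Fin k}
    (h : (F i).lab l = some v) : (product F).lab l = some (Quot.mk (Glue F) ⟨i, v⟩) := by
  have hx : ∃ x : (Σ i, (F i).V), (F x.1).lab l = some x.2 := ⟨⟨i, v⟩, h⟩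
  simp only [product, dif_pos hx]
  exact congrArg some (Quot.sound ⟨l, hx.choose_spec, h⟩)

end Product

end LabelledGraph

/-- `ConstructionTree k G` is the type of `k`-construction trees with root graph `G`.
Nodes carry labelled graphs: leaves carry fully labelled graphs, the graph at a node with exactly
one child arises from the graph at the child by removing one label, and the graph at a node with
`n ≥ 2` children is the product of the graphs at the children (up to isomorphism). -/
inductive ConstructionTree (k : ℕ) : LabelledGraph k → Type 1
  | leaf (G : LabelledGraph k) (hG : G.FullyLabelled) : ConstructionTree k G
  | elimination (G G' : LabelledGraph k) (l : Fin k) (hG : G.Isomorphic (G'.remove l))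
      (t : ConstructionTree k G') : ConstructionTree k G
  | product (G : LabelledGraph k) (n : ℕ) (hn : 2 ≤ n) (F : Fin n → LabelledGraph k)
      (hG : G.Isomorphic (LabelledGraph.product F))
      (t : ∀ i, ConstructionTree k (F i)) : ConstructionTree k G

namespace ConstructionTree

variable {k : ℕ}

/-- The maximum number of elimination nodes on a path from the root to a leaf. -/
def eliminationDepth : {G : LabelledGraph k} → ConstructionTree k G → ℕ
  | _, leaf _ _ => 0
  | _, elimination _ _ _ _ t => t.eliminationDepth + 1
  | _, product _ _ _ _ _ t => Finset.univ.sup fun i => (t i).eliminationDepth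

/-- At every elimination node, the removed label has a labelled neighbour. -/
def Guarded : {G : LabelledGraph k} → ConstructionTree k G → Prop
  | _, leaf _ _ => True
  | _, elimination _ G' l _ t => G'.HasLabelledNeighbour l ∧ t.Guarded
  | _, product _ _ _ _ _ t => ∀ i, (t i).Guarded

end ConstructionTree

/-- The class of `k`-labelled graphs that admit a guarded `k`-construction tree of elimination
depth at most `q`. -/
def GuardedL (k q : ℕ) (G : LabelledGraph k) : Prop :=
  ∃ t : ConstructionTree k G, t.Guarded ∧ t.eliminationDepth ≤ q

/-- The class of unlabelled graphs obtained by removing all labels from the members of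
`GuardedL k q` that have exactly one labelled vertex. -/
def GuardedT (k q : ℕ) (X : Type) (F : SimpleGraph X) : Prop :=
  ∃ L : LabelledGraph k, GuardedL k q L ∧ L.SingleLabelledVertex ∧ Nonempty (F ≃g L.graph)

/-- Homomorphism indistinguishability over a class of finite graphs. -/
def HomIndistinguishable (C : ∀ X : Type, SimpleGraph X → Prop) {V W : Type*}
    (G : SimpleGraph V) (H : SimpleGraph W) : Prop :=
  ∀ (X : Type) [Finite X] (F : SimpleGraph X), C X F →
    Nat.card (F →g G) = Nat.card (F →g H)

/-- Formulas of guarded counting logic over the variables `x₀, x₁, …`. The only quantifier is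
`existsGe t x y _ ψ`, which stands for `∃^{≥ t} y (E x y ∧ ψ)` with `x` and `y` distinct. -/
inductive GCFormula : Type
  | eq (x y : ℕ) : GCFormula
  | edge (x y : ℕ) : GCFormula
  | not (φ : GCFormula) : GCFormula
  | and (φ ψ : GCFormula) : GCFormula
  | or (φ ψ : GCFormula) : GCFormula
  | imp (φ ψ : GCFormula) : GCFormula
  | existsGe (t x y : ℕ) (hxy : x ≠ y) (ψ : GCFormula) : GCFormula

namespace GCFormula

/-- All variables that occur in a formula. -/
def vars : GCFormula → Finset ℕ
  | eq x y => {x, y}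
  | edge x y => {x, y}
  | not φ => φ.vars
  | and φ ψ => φ.vars ∪ ψ.vars
  | or φ ψ => φ.vars ∪ ψ.vars
  | imp φ ψ => φ.vars ∪ ψ.vars
  | existsGe _ x y _ ψ => {x, y} ∪ ψ.vars

/-- The free variables of a formula. -/
def free : GCFormula → Finset ℕ
  | eq x y => {x, y}
  | edge x y => {x, y}
  | not φ => φ.free
  | and φ ψ => φ.free ∪ ψ.free
  | or φ ψ => φ.free ∪ ψ.free
  | imp φ ψ => φ.free ∪ ψ.free
  | existsGe _ x y _ ψ => ({x, y} ∪ ψ.free).erase y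

/-- The quantifier rank. -/
def qr : GCFormula → ℕ
  | eq _ _ => 0
  | edge _ _ => 0
  | not φ => φ.qr
  | and φ ψ => max φ.qr ψ.qr
  | or φ ψ => max φ.qr ψ.qr
  | imp φ ψ => max φ.qr ψ.qr
  | existsGe _ _ _ _ ψ => 1 + ψ.qr

/-- Satisfaction in the graph `G` under the interpretation `I` of the variables. -/
def Sat {V : Type*} (G : SimpleGraph V) : (ℕ → V) → GCFormula → Prop
  | I, eq x y => I x = I y
  | I, edge x y => G.Adj (I x) (I y)
  | I, not φ => ¬ Sat G I φ
  | I, and φ ψ => Sat G I φ ∧ Sat G I ψ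
  | I, or φ ψ => Sat G I φ ∨ Sat G I ψ
  | I, imp φ ψ => Sat G I φ → Sat G I ψ
  | I, existsGe t x y _ ψ => ∃ s : Finset V, s.card = t ∧
      ∀ u ∈ s, G.Adj (I x) u ∧ Sat G (Function.update I y u) ψ

end GCFormula

/-- The fragment of formulas with at most `k` distinct variables and quantifier rank at
most `q`. -/
def GC (k q : ℕ) : Set GCFormula :=
  {φ | φ.vars.card ≤ k ∧ φ.qr ≤ q}

/-- Equivalence of graphs with respect to the fragment `GC k q`: some bijection between the vertex
sets preserves every formula `φ(x)` of the fragment. Interpreting all variables by `v` amounts to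
interpreting `x` by `v`, as no other variable is free in `φ`. -/
def GCEquivalent (k q : ℕ) {V W : Type*} (G : SimpleGraph V) (H : SimpleGraph W) : Prop :=
  ∃ f : V ≃ W, ∀ (v : V) (x : ℕ), ∀ φ ∈ GC k q, φ.free ⊆ {x} →
    (φ.Sat G (fun _ => v) ↔ φ.Sat H (fun _ => f v))

/-! Both equivalences amount to a bijection f of the vertices such that Duplicator wins the q-round
guarded bijective pebble game with all pebbles on v and on f(v).

Towards the game: a move is a bijection between two neighbourhoods. Indicators of formulas are
closed under products by conjunction, and rooted homomorphism counts by gluing; a guarded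
quantifier, or the removal of a guarded label, sums such a function over the neighbours of a root.
`exists_equiv_of_sum_eq` turns equality of all these sums into Duplicator's bijection.

From the game: induction on the formula or on the construction tree. A quantifier uses one round,
and an elimination node at most one.

Two points need care. A product suppresses loops: adjacent labelled vertices of one factor may be
identified through another factor, and then ordinary rooted counts are not multiplicative. The
induction on trees therefore ignores edges between labelled vertices (`R := True`) and tests an edge
only when an end loses its last label. For the converse, injectively labelled graphs suffice; their
products create no loops, so ordinary counts (`R := False`) multiply. Such graphs offer no direct
test for equality of roots, so the game compares adjacency only; `GuardedGame.forth` recovers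
equality by modifying Duplicator's bijection. -/

/-! ### Constructing bijections -/

/-- Two finite sets carrying families of functions that are indexed alike, closed under products
and have equal sums are in bijection in such a way that all the functions are preserved. -/
theorem exists_equiv_of_sum_eq {ι A B : Type*} [Fintype A] [Fintype B] (a : ι → A → ℕ)
    (b : ι → B → ℕ) (one : ∃ i, (∀ y, a i y = 1) ∧ ∀ z, b i z = 1)
    (mul : ∀ i j, ∃ m, (∀ y, a m y = a i y * a j y) ∧ ∀ z, b m z = b i z * b j z)
    (sum : ∀ i, ∑ y, a i y = ∑ z, b i z) :
    ∃ e : A ≃ B, ∀ i y, a i y = b i (e y) := by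
  classical
  let c : ι → A ⊕ B → ℚ := fun i => Sum.elim (fun y => (a i y : ℚ)) fun z => (b i z : ℚ)
  let M : Submonoid (A ⊕ B → ℚ) :=
    { carrier := Set.range c
      one_mem' := by
        obtain ⟨i, h1, h2⟩ := one
        exact ⟨i, by ext (y | z) <;> simp [c, h1, h2]⟩
      mul_mem' := by
        rintro _ _ ⟨i, rfl⟩ ⟨j, rfl⟩
        obtain ⟨m, h1, h2⟩ := mul i j
        exact ⟨m, by ext (y | z) <;> simp [c, h1, h2]⟩ }
  -- Equality of sums is a linear condition, and the span of a multiplicative monoid is already an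
  -- algebra.
  have key : ∀ p ∈ Algebra.adjoin ℚ (M : Set (A ⊕ B → ℚ)),
      ∑ y, p (Sum.inl y) = ∑ z, p (Sum.inr z) := by
    intro p hp
    rw [← Subalgebra.mem_toSubmodule, Algebra.adjoin_eq_span, Submonoid.closure_eq] at hp
    induction hp using Submodule.span_induction with
    | mem p h =>
      obtain ⟨i, rfl⟩ := h
      simpa [c] using congrArg (Nat.cast : ℕ → ℚ) (sum i)
    | zero => simp
    | add p r _ _ h1 h2 => simp [Finset.sum_add_distrib, h1, h2]
    | smul t p _ h => simp [← Finset.mul_sum, h]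
  have cls : ∀ s₀ : A ⊕ B,
      Nat.card {y : A // (fun i => c i (Sum.inl y)) = fun i => c i s₀} =
        Nat.card {z : B // (fun i => c i (Sum.inr z)) = fun i => c i s₀} := by
    intro s₀
    -- For each point `s` outside the class of `s₀`, a factor that kills `s` but not `s₀`; the
    -- product of all factors is a nonzero multiple of the indicator of the class.
    have hsep : ∀ s : A ⊕ B, ∃ r ∈ Algebra.adjoin ℚ (M : Set (A ⊕ B → ℚ)),
        (∀ t, ((fun i => c i t) = fun i => c i s₀) → r t = r s₀) ∧ r s₀ ≠ 0 ∧
        (((fun i => c i s) ≠ fun i => c i s₀) → r s = 0) := by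
      intro s
      by_cases hs : (fun i => c i s) = fun i => c i s₀
      · exact ⟨1, one_mem _, fun _ _ => rfl, one_ne_zero, fun h => absurd hs h⟩
      · obtain ⟨i, hi⟩ := Function.ne_iff.1 hs
        refine ⟨c i - algebraMap ℚ _ (c i s), sub_mem (Algebra.subset_adjoin ⟨i, rfl⟩)
          (Subalgebra.algebraMap_mem _ _), fun t ht => ?_, ?_, fun _ => ?_⟩
        · simp [Pi.algebraMap_apply, congrFun ht i]
        · simpa [Pi.algebraMap_apply, sub_eq_zero] using fun h => hi h.symm
        · simp [Pi.algebraMap_apply]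
    choose r hr h1 h2 h3 using hsep
    have hp := key (∏ s, r s) (Subalgebra.prod_mem _ fun s _ => hr s)
    have hval : ∀ t, (∏ s, r s) t =
        if (fun i => c i t) = (fun i => c i s₀) then ∏ s, r s s₀ else 0 := by
      intro t
      rw [Finset.prod_apply]
      split_ifs with ht
      · exact Finset.prod_congr rfl fun s _ => h1 s t ht
      · exact Finset.prod_eq_zero (Finset.mem_univ t) (h3 t ht)
    have hne : ∏ s, r s s₀ ≠ 0 := Finset.prod_ne_zero_iff.2 fun s _ => h2 s
    simp only [hval, ← Finset.sum_filter, Finset.sum_const, nsmul_eq_mul] at hp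
    have := mul_right_cancel₀ hne hp
    rw [Nat.card_eq_fintype_card, Nat.card_eq_fintype_card, Fintype.card_subtype,
      Fintype.card_subtype]
    exact_mod_cast this
  have fib : ∀ d : ι → ℚ, Nonempty ({y : A // (fun i => c i (Sum.inl y)) = d} ≃
      {z : B // (fun i => c i (Sum.inr z)) = d}) := by
    intro d
    by_cases h : ∃ s : A ⊕ B, (fun i => c i s) = d
    · obtain ⟨s, rfl⟩ := h
      exact Finite.card_eq.1 (cls s)
    · have : IsEmpty {y : A // (fun i => c i (Sum.inl y)) = d} := ⟨fun y => h ⟨_, y.2⟩⟩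
      have : IsEmpty {z : B // (fun i => c i (Sum.inr z)) = d} := ⟨fun z => h ⟨_, z.2⟩⟩
      exact ⟨Equiv.equivOfIsEmpty _ _⟩
  let e := Equiv.ofFiberEquiv fun d => (fib d).some
  refine ⟨e, fun i y => ?_⟩
  have h := congrFun (Equiv.ofFiberEquiv_map (fun d => (fib d).some) y) i
  have h' : (b i (e y) : ℚ) = a i y := h
  exact_mod_cast h'.symm

/-- A bijection inside a difunctional relation can be modified so as to respect finitely many
prescribed pairs of the relation. -/
theorem exists_equiv_extending {A B ι : Type*} (T : A → B → Prop)
    (hT : ∀ y z y' z', T y z → T y' z → T y' z' → T y z') (f : A ≃ B) (hf : ∀ y, T y (f y))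
    (a : ι → A) (b : ι → B) (hab : ∀ i, T (a i) (b i)) (h : ∀ i j, a i = a j ↔ b i = b j)
    (s : Finset ι) : ∃ e : A ≃ B, (∀ y, T y (e y)) ∧ ∀ i ∈ s, e (a i) = b i := by
  classical
  induction s using Finset.induction_on with
  | empty => exact ⟨f, hf, by simp⟩
  | insert j s _ ih =>
    obtain ⟨e, he, hs⟩ := ih
    have hj : (e.trans (Equiv.swap (e (a j)) (b j))) (a j) = b j := by simp
    refine ⟨e.trans (Equiv.swap (e (a j)) (b j)), fun y => ?_, fun i hi => ?_⟩
    · rw [Equiv.trans_apply, Equiv.swap_apply_def]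
      split_ifs with h1 h2
      · rw [e.injective h1]; exact hab j
      -- The swap sends the former preimage of `b j` to `e (a j)`; difunctionality admits this new
      -- pair.
      · exact hT y (b j) (a j) _ (h2 ▸ he y) (hab j) (he _)
      · exact he y
    · by_cases hij : a i = a j
      · rw [hij, hj, (h i j).1 hij]
      · have hi : i ∈ s := by
          rcases Finset.mem_insert.1 hi with rfl | hi
          · exact absurd rfl hij
          · exact hi
        rw [Equiv.trans_apply, Equiv.swap_apply_of_ne_of_ne (fun h' => hij (e.injective h')),
          hs i hi]
        rw [hs i hi]
        exact fun h' => hij ((h i j).2 h')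

theorem update_comp_of_ne {ι U : Type*} [DecidableEq ι] {τ : ι → ι} {j l : ι}
    (h : ∀ i, i ≠ j → τ i ≠ l) (x : ι → U) (u : U) :
    Function.update (x ∘ τ) j u = Function.update x l u ∘ Function.update τ j l := by
  ext i
  by_cases hi : i = j
  · subst hi; simp
  · simp [hi, h i hi]

/-! ### The guarded bijective pebble game -/

section Game

variable {k : ℕ} {V W : Type*} (G : SimpleGraph V) (H : SimpleGraph W)

/-- Duplicator wins the `q`-round guarded bijective pebble game from the positions `x` and `x'`,
where positions are compared with respect to adjacency only. -/
def GuardedGame : ℕ → (Fin k → V) → (Fin k → W) → Prop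
  | 0, x, x' => ∀ i j, G.Adj (x i) (x j) ↔ H.Adj (x' i) (x' j)
  | q + 1, x, x' => (∀ i j, G.Adj (x i) (x j) ↔ H.Adj (x' i) (x' j)) ∧
      ∀ g l, g ≠ l → ∃ f : {y // G.Adj (x g) y} ≃ {z // H.Adj (x' g) z},
        ∀ y : {y // G.Adj (x g) y}, GuardedGame q (Function.update x l y) (Function.update x' l (f y))

/-- Two tuples have the same equality pattern. -/
def SameEq {ι : Type*} (x : ι → V) (x' : ι → W) : Prop :=
  ∀ i j, x i = x j ↔ x' i = x' j

namespace GuardedGame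

variable {G H}

theorem adj {q : ℕ} {x : Fin k → V} {x' : Fin k → W} (h : GuardedGame G H q x x') (i j : Fin k) :
    G.Adj (x i) (x j) ↔ H.Adj (x' i) (x' j) := by
  cases q with
  | zero => exact h i j
  | succ q => exact h.1 i j

theorem of_succ {q : ℕ} {x : Fin k → V} {x' : Fin k → W} (h : GuardedGame G H (q + 1) x x') :
    GuardedGame G H q x x' := by
  induction q generalizing x x' with
  | zero => exact h.1
  | succ q ih =>
    refine ⟨h.1, fun g l hgl => ?_⟩
    obtain ⟨f, hf⟩ := h.2 g l hgl
    exact ⟨f, fun y => ih (hf y)⟩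

/-- Replaces transitivity for a relation between two different graphs; Duplicator goes along the
first bijection, back along the second and forth along the third. -/
theorem difunctional {q : ℕ} {x y : Fin k → V} {z w : Fin k → W} (h₁ : GuardedGame G H q x z)
    (h₂ : GuardedGame G H q y z) (h₃ : GuardedGame G H q y w) : GuardedGame G H q x w := by
  induction q generalizing x y z w with
  | zero => exact fun i j => (h₁ i j).trans ((h₂ i j).symm.trans (h₃ i j))
  | succ q ih =>
    refine ⟨fun i j => (h₁.1 i j).trans ((h₂.1 i j).symm.trans (h₃.1 i j)), fun g l hgl => ?_⟩
    obtain ⟨f₁, hf₁⟩ := h₁.2 g l hgl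
    obtain ⟨f₂, hf₂⟩ := h₂.2 g l hgl
    obtain ⟨f₃, hf₃⟩ := h₃.2 g l hgl
    refine ⟨f₁.trans (f₂.symm.trans f₃), fun u => ih (hf₁ u) ?_ (hf₃ _)⟩
    simpa using hf₂ (f₂.symm (f₁ u))

/-- A back-and-forth family for partial positions, where `D` is the set of pebbles in use, yields
winning positions of the game. -/
theorem of_family (P : ℕ → Set (Fin k) → (Fin k → V) → (Fin k → W) → Prop)
    (atom : ∀ q D x x', P q D x x' → ∀ i ∈ D, ∀ j ∈ D, G.Adj (x i) (x j) ↔ H.Adj (x' i) (x' j))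
    (forth : ∀ q D x x', P (q + 1) D x x' → ∀ g ∈ D, ∀ l, g ≠ l →
      ∃ f : {y // G.Adj (x g) y} ≃ {z // H.Adj (x' g) z},
        ∀ y : {y // G.Adj (x g) y}, P q (insert l D) (Function.update x l y) (Function.update x' l (f y)))
    {q : ℕ} {D : Set (Fin k)} {x : Fin k → V} {x' : Fin k → W} (h : P q D x x')
    (τ : Fin k → Fin k) (hτ : ∀ i, τ i ∈ D) : GuardedGame G H q (x ∘ τ) (x' ∘ τ) := by
  induction q generalizing D x x' τ with
  | zero => exact fun i j => atom _ _ _ _ h _ (hτ i) _ (hτ j)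
  | succ q ih =>
    refine ⟨fun i j => atom _ _ _ _ h _ (hτ i) _ (hτ j), fun g j hgj => ?_⟩
    -- Pigeonhole: the `k - 1` pebbles other than `j` occupy at most `k - 1` indices under `τ`, so
    -- some index is free for the move.
    obtain ⟨l, hl⟩ : ∃ l, ∀ i, i ≠ j → τ i ≠ l := by
      by_contra! hcon
      have hsub : (Finset.univ : Finset (Fin k)) ⊆ (Finset.univ.erase j).image τ := by
        intro l _
        obtain ⟨i, hi, hil⟩ := hcon l
        exact Finset.mem_image.2 ⟨i, by simp [hi], hil⟩
      have h1 := (Finset.card_le_card hsub).trans Finset.card_image_le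
      rw [Finset.card_erase_of_mem (Finset.mem_univ j), Finset.card_univ, Fintype.card_fin] at h1
      have := j.pos
      omega
    obtain ⟨f, hf⟩ := forth _ _ _ _ h (τ g) (hτ g) l (hl g hgj)
    refine ⟨f, fun y => ?_⟩
    rw [update_comp_of_ne hl, update_comp_of_ne hl]
    refine ih (hf y) _ fun i => ?_
    by_cases hi : i = j
    · subst hi; simp
    · simp [hi, hτ i]

/-- Pebbles may be permuted or stacked: winning positions themselves form a back-and-forth family
with every pebble in use. -/
theorem comp {q : ℕ} {x : Fin k → V} {x' : Fin k → W} (h : GuardedGame G H q x x')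
    (τ : Fin k → Fin k) : GuardedGame G H q (x ∘ τ) (x' ∘ τ) :=
  of_family (fun q _ x x' => GuardedGame G H q x x') (fun _ _ _ _ h i _ j _ => h.adj i j)
    (fun _ _ _ _ h g _ l hgl => h.2 g l hgl) (D := Set.univ) h τ fun _ => trivial

theorem update_self {q : ℕ} {x : Fin k → V} {x' : Fin k → W} (h : GuardedGame G H q x x')
    (l i : Fin k) : GuardedGame G H q (Function.update x l (x i)) (Function.update x' l (x' i)) := by
  have := h.comp (Function.update id l i)
  rwa [Function.comp_update, Function.comp_update, Function.comp_id, Function.comp_id] at this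

/-- Duplicator can answer in such a way that equalities are respected as well. -/
theorem forth {q : ℕ} {x : Fin k → V} {x' : Fin k → W} (h : GuardedGame G H (q + 1) x x')
    (hx : SameEq x x') {g l : Fin k} (hgl : g ≠ l) :
    ∃ f : {y // G.Adj (x g) y} ≃ {z // H.Adj (x' g) z},
      ∀ y : {y // G.Adj (x g) y}, GuardedGame G H q (Function.update x l y) (Function.update x' l (f y)) ∧
        SameEq (Function.update x l (y : V)) (Function.update x' l (f y : W)) := by
  obtain ⟨f₀, hf₀⟩ := h.2 g l hgl
  classical
  -- A vertex under pebble `i` is to be answered by the vertex under the same pebble. This answer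
  -- wins by `update_self`, so the bijection can be altered to contain it.
  obtain ⟨f, hf, hs⟩ := exists_equiv_extending
    (fun (y : {y // G.Adj (x g) y}) (z : {z // H.Adj (x' g) z}) =>
      GuardedGame G H q (Function.update x l y) (Function.update x' l z))
    (fun _ _ _ _ => difunctional) f₀ hf₀
    (fun i : {i // G.Adj (x g) (x i)} => ⟨x i, i.2⟩)
    (fun i => ⟨x' i, (h.adj g i).1 i.2⟩) (fun i => h.of_succ.update_self l i)
    (fun i j => by simpa using hx i j) Finset.univ
  have hfx : ∀ (y : {y // G.Adj (x g) y}) (i : Fin k), (y : V) = x i ↔ (f y : W) = x' i := by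
    intro y i
    constructor
    · intro hy
      have hi : G.Adj (x g) (x i) := hy ▸ y.2
      have := hs ⟨i, hi⟩ (Finset.mem_univ _)
      rw [show y = ⟨x i, hi⟩ from Subtype.ext hy, this]
    · intro hy
      have hi : G.Adj (x g) (x i) := (h.adj g i).2 (hy ▸ (f y).2)
      have := hs ⟨i, hi⟩ (Finset.mem_univ _)
      have h2 : f y = f ⟨x i, hi⟩ := Subtype.ext (by rw [this, hy])
      rw [f.injective h2]
  refine ⟨f, fun y => ⟨hf y, fun i j => ?_⟩⟩
  by_cases hi : i = l <;> by_cases hj : j = l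
  · simp [hi, hj]
  · subst hi; simpa [hj] using hfx y j
  · subst hj; simpa [hi, eq_comm] using hfx y i
  · simpa [hi, hj] using hx i j

end GuardedGame

end Game

/-! ### Guarded counting logic and the game -/

theorem exists_finset_card_iff {V : Type*} [Finite V] (t : ℕ) (p : V → Prop) :
    (∃ s : Finset V, s.card = t ∧ ∀ u ∈ s, p u) ↔ t ≤ Nat.card {u // p u} := by
  classical
  have := Fintype.ofFinite V
  rw [Nat.card_eq_fintype_card, Fintype.card_subtype]
  constructor
  · rintro ⟨s, rfl, hs⟩
    exact Finset.card_le_card fun u hu => by simpa using hs u hu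
  · intro h
    obtain ⟨s, hs, hc⟩ := Finset.exists_subset_card_eq h
    exact ⟨s, hc, fun u hu => by simpa using hs hu⟩

theorem ite_eq_mul_of_iff_and {p q r : Prop} [Decidable p] [Decidable q] [Decidable r]
    (h : r ↔ p ∧ q) : (if r then 1 else 0) = (if p then 1 else 0) * if q then 1 else 0 := by
  by_cases hp : p <;> by_cases hq : q <;> simp [h, hp, hq]

namespace GCFormula

theorem sat_congr {V : Type*} (G : SimpleGraph V) {φ : GCFormula} {I J : ℕ → V}
    (h : ∀ n ∈ φ.vars, I n = J n) : φ.Sat G I ↔ φ.Sat G J := by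
  induction φ generalizing I J with
  | eq x y => simp [Sat, h x (by simp [vars]), h y (by simp [vars])]
  | edge x y => simp [Sat, h x (by simp [vars]), h y (by simp [vars])]
  | not φ ih => exact not_congr (ih h)
  | and φ ψ ih₁ ih₂ =>
    exact and_congr (ih₁ fun n hn => h n (by simp [vars, hn]))
      (ih₂ fun n hn => h n (by simp [vars, hn]))
  | or φ ψ ih₁ ih₂ =>
    exact or_congr (ih₁ fun n hn => h n (by simp [vars, hn]))
      (ih₂ fun n hn => h n (by simp [vars, hn]))
  | imp φ ψ ih₁ ih₂ =>
    exact imp_congr (ih₁ fun n hn => h n (by simp [vars, hn]))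
      (ih₂ fun n hn => h n (by simp [vars, hn]))
  | existsGe t x y hxy ψ ih =>
    have hu : ∀ u, ψ.Sat G (Function.update I y u) ↔ ψ.Sat G (Function.update J y u) := by
      intro u
      refine ih fun n hn => ?_
      by_cases hy : n = y
      · subst hy; simp
      · simp [hy, h n (by simp [vars, hn])]
    simp only [Sat, hu, h x (by simp [vars])]

theorem sat_existsGe {V : Type*} [Finite V] (G : SimpleGraph V) (I : ℕ → V) (t x y : ℕ)
    (hxy : x ≠ y) (ψ : GCFormula) : (existsGe t x y hxy ψ).Sat G I ↔
      t ≤ Nat.card {u : {u // G.Adj (I x) u} // ψ.Sat G (Function.update I y u)} := by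
  rw [Sat, exists_finset_card_iff]
  exact iff_of_eq (congrArg (t ≤ ·) (Nat.card_congr (Equiv.subtypeSubtypeEquivSubtypeInter
    (fun u => G.Adj (I x) u) fun u => ψ.Sat G (Function.update I y u)).symm))

end GCFormula

section

variable {k : ℕ} {V W : Type*} [Finite V] [Finite W] {G : SimpleGraph V} {H : SimpleGraph W}

/-- Winning positions satisfy the same formulas. -/
theorem GuardedGame.sat_iff {q : ℕ} {x : Fin k → V} {x' : Fin k → W} (h : GuardedGame G H q x x')
    (hx : SameEq x x') {φ : GCFormula} (hq : φ.qr ≤ q) {ρ : ℕ → Fin k}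
    (hρ : Set.InjOn ρ φ.vars) {I : ℕ → V} {J : ℕ → W} (hI : ∀ n ∈ φ.vars, I n = x (ρ n))
    (hJ : ∀ n ∈ φ.vars, J n = x' (ρ n)) : φ.Sat G I ↔ φ.Sat H J := by
  induction φ generalizing q x x' I J with
  | eq a b =>
    have ha : a ∈ (GCFormula.eq a b).vars := by simp [GCFormula.vars]
    have hb : b ∈ (GCFormula.eq a b).vars := by simp [GCFormula.vars]
    simp only [GCFormula.Sat, hI a ha, hI b hb, hJ a ha, hJ b hb]
    exact hx _ _
  | edge a b =>
    have ha : a ∈ (GCFormula.edge a b).vars := by simp [GCFormula.vars]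
    have hb : b ∈ (GCFormula.edge a b).vars := by simp [GCFormula.vars]
    simp only [GCFormula.Sat, hI a ha, hI b hb, hJ a ha, hJ b hb]
    exact h.adj _ _
  | not φ ih => exact not_congr (ih h hx hq hρ hI hJ)
  | and φ ψ ih₁ ih₂ =>
    have h₁ : φ.vars ⊆ (φ.and ψ).vars := Finset.subset_union_left
    have h₂ : ψ.vars ⊆ (φ.and ψ).vars := Finset.subset_union_right
    exact and_congr (ih₁ h hx ((le_max_left _ _).trans hq) (hρ.mono h₁)
        (fun n hn => hI n (h₁ hn)) fun n hn => hJ n (h₁ hn))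
      (ih₂ h hx ((le_max_right _ _).trans hq) (hρ.mono h₂)
        (fun n hn => hI n (h₂ hn)) fun n hn => hJ n (h₂ hn))
  | or φ ψ ih₁ ih₂ =>
    have h₁ : φ.vars ⊆ (φ.or ψ).vars := Finset.subset_union_left
    have h₂ : ψ.vars ⊆ (φ.or ψ).vars := Finset.subset_union_right
    exact or_congr (ih₁ h hx ((le_max_left _ _).trans hq) (hρ.mono h₁)
        (fun n hn => hI n (h₁ hn)) fun n hn => hJ n (h₁ hn))
      (ih₂ h hx ((le_max_right _ _).trans hq) (hρ.mono h₂)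
        (fun n hn => hI n (h₂ hn)) fun n hn => hJ n (h₂ hn))
  | imp φ ψ ih₁ ih₂ =>
    have h₁ : φ.vars ⊆ (φ.imp ψ).vars := Finset.subset_union_left
    have h₂ : ψ.vars ⊆ (φ.imp ψ).vars := Finset.subset_union_right
    exact imp_congr (ih₁ h hx ((le_max_left _ _).trans hq) (hρ.mono h₁)
        (fun n hn => hI n (h₁ hn)) fun n hn => hJ n (h₁ hn))
      (ih₂ h hx ((le_max_right _ _).trans hq) (hρ.mono h₂)
        (fun n hn => hI n (h₂ hn)) fun n hn => hJ n (h₂ hn))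
  | existsGe t a b hab ψ ih =>
    have ha : a ∈ (GCFormula.existsGe t a b hab ψ).vars := by simp [GCFormula.vars]
    have hb : b ∈ (GCFormula.existsGe t a b hab ψ).vars := by simp [GCFormula.vars]
    have hψ : ψ.vars ⊆ (GCFormula.existsGe t a b hab ψ).vars := Finset.subset_union_right
    obtain ⟨q, rfl⟩ : ∃ r, q = r + 1 := by
      simp only [GCFormula.qr] at hq
      exact ⟨q - 1, by omega⟩
    obtain ⟨f, hf⟩ := h.forth hx (fun hρab => hab (hρ ha hb hρab) : ρ a ≠ ρ b)
    rw [GCFormula.sat_existsGe, GCFormula.sat_existsGe, hI a ha, hJ a ha]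
    -- By induction Duplicator's bijection restricts to the neighbours that satisfy `ψ`, so their
    -- numbers agree.
    refine iff_of_eq (congrArg (t ≤ ·) (Nat.card_congr (f.subtypeEquiv fun u => ?_)))
    have hne : ∀ n ∈ ψ.vars, n ≠ b → ρ n ≠ ρ b := fun n hn hnb h' => hnb (hρ (hψ hn) hb h')
    refine ih (hf u).1 (hf u).2 (by simp only [GCFormula.qr] at hq; omega) (hρ.mono hψ)
      (fun n hn => ?_) fun n hn => ?_
    · by_cases hnb : n = b
      · subst hnb; simp
      · simp [hnb, hne n hn hnb, hI n (hψ hn)]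
    · by_cases hnb : n = b
      · subst hnb; simp
      · simp [hnb, hne n hn hnb, hJ n (hψ hn)]

theorem Finset.exists_injOn_fin (s : Finset ℕ) (hs : s.card ≤ k) (hk : 1 ≤ k) :
    ∃ ρ : ℕ → Fin k, Set.InjOn ρ s := by
  classical
  refine ⟨fun n => if h : n ∈ s then Fin.castLE hs (s.equivFin ⟨n, h⟩) else ⟨0, hk⟩, ?_⟩
  intro m hm n hn h
  have hm : m ∈ s := hm
  have hn : n ∈ s := hn
  simpa [hm, hn] using h

/-- Agreement on all formulas over the variables `x₀, …, x_{k - 1}` whose free variables lie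
in `D`. -/
def SameFormulas [NeZero k] (G : SimpleGraph V) (H : SimpleGraph W) (q : ℕ) (D : Set (Fin k))
    (x : Fin k → V) (x' : Fin k → W) : Prop :=
  ∀ φ : GCFormula, φ.qr ≤ q → (∀ n ∈ φ.vars, n < k) → (∀ i : Fin k, (i : ℕ) ∈ φ.free → i ∈ D) →
    (φ.Sat G (x ∘ Fin.ofNat k) ↔ φ.Sat H (x' ∘ Fin.ofNat k))

theorem Fin.ofNat_val_eq [NeZero k] (i : Fin k) : Fin.ofNat k i = i :=
  Fin.ext (Nat.mod_eq_of_lt i.2)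

theorem GCFormula.sat_update_comp_ofNat [NeZero k] {U : Type*} (K : SimpleGraph U)
    {ψ : GCFormula} (hψ : ∀ n ∈ ψ.vars, n < k) (x : Fin k → U) (l : Fin k) (u : U) :
    ψ.Sat K (Function.update x l u ∘ Fin.ofNat k) ↔
      ψ.Sat K (Function.update (x ∘ Fin.ofNat k) l u) := by
  refine sat_congr K fun n hn => ?_
  have hmod : (Fin.ofNat k n : ℕ) = n := Nat.mod_eq_of_lt (hψ n hn)
  by_cases h : n = l
  · subst h; simp
  · have : Fin.ofNat k n ≠ l := fun h' => h (by rw [← h', hmod])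
    simp only [Function.comp_apply, Function.update_of_ne this, Function.update_of_ne h]

/-- The sum of the indicator of `ψ` over a neighbourhood is the number that the guarded quantifiers
bound from below; thresholds of all sizes determine it. -/
theorem SameFormulas.guardedGame [NeZero k] {q : ℕ} {D : Set (Fin k)} {x : Fin k → V}
    {x' : Fin k → W} (h : SameFormulas G H q D x x') (τ : Fin k → Fin k) (hτ : ∀ i, τ i ∈ D) :
    GuardedGame G H q (x ∘ τ) (x' ∘ τ) := by
  classical
  refine GuardedGame.of_family (SameFormulas G H) ?_ ?_ h τ hτ
  · intro q D x x' h i hi j hj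
    have := h (.edge i j) (Nat.zero_le _) (by simp [GCFormula.vars])
      (by simp only [GCFormula.free, Finset.mem_insert, Finset.mem_singleton, Fin.val_inj]
          rintro m (rfl | rfl) <;> assumption)
    simpa [GCFormula.Sat, Fin.ofNat_val_eq] using this
  · intro q D x x' h g hg l hgl
    let Ψ := {φ : GCFormula // φ.qr ≤ q ∧ (∀ n ∈ φ.vars, n < k) ∧
      ∀ i : Fin k, (i : ℕ) ∈ φ.free → i ∈ insert l D}
    have := Fintype.ofFinite {y // G.Adj (x g) y}
    have := Fintype.ofFinite {z // H.Adj (x' g) z}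
    obtain ⟨f, hf⟩ := exists_equiv_of_sum_eq
      (fun (ψ : Ψ) (y : {y // G.Adj (x g) y}) =>
        if ψ.1.Sat G (Function.update x l y ∘ Fin.ofNat k) then 1 else 0)
      (fun (ψ : Ψ) (z : {z // H.Adj (x' g) z}) =>
        if ψ.1.Sat H (Function.update x' l z ∘ Fin.ofNat k) then 1 else 0)
      -- A tautology serves as the constant function 1.
      ⟨⟨.eq l l, Nat.zero_le _, by simp [GCFormula.vars], by
        simp only [GCFormula.free, Finset.mem_insert, Finset.mem_singleton, Fin.val_inj]
        rintro m (rfl | rfl) <;> exact Set.mem_insert _ _⟩, by simp [GCFormula.Sat]⟩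
      (by
        rintro ⟨φ, h1, h2, h3⟩ ⟨ψ, h4, h5, h6⟩
        refine ⟨⟨φ.and ψ, max_le h1 h4, fun n hn => ?_, fun i hi => ?_⟩, ?_⟩
        · exact (Finset.mem_union.1 hn).elim (h2 n) (h5 n)
        · exact (Finset.mem_union.1 hi).elim (h3 i) (h6 i)
        · exact ⟨fun y => ite_eq_mul_of_iff_and Iff.rfl, fun y => ite_eq_mul_of_iff_and Iff.rfl⟩)
      (by
        rintro ⟨ψ, h1, h2, h3⟩
        have hcard : ∀ t, t ≤ Nat.card {u : {u // G.Adj (x g) u} //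
              ψ.Sat G (Function.update x l u ∘ Fin.ofNat k)} ↔
            t ≤ Nat.card {u : {u // H.Adj (x' g) u} //
              ψ.Sat H (Function.update x' l u ∘ Fin.ofNat k)} := by
          intro t
          have := h (.existsGe t g l (Fin.val_injective.ne hgl) ψ)
            (by simp only [GCFormula.qr]; omega)
            (by
              simp only [GCFormula.vars, Finset.mem_union, Finset.mem_insert,
                Finset.mem_singleton]
              rintro n ((rfl | rfl) | hn)
              exacts [g.2, l.2, h2 n hn])
            (by
              simp only [GCFormula.free, Finset.mem_union, Finset.mem_insert, Finset.mem_erase,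
                Finset.mem_singleton, Fin.val_inj]
              rintro i ⟨hil, (rfl | rfl) | hi⟩
              · exact hg
              · exact absurd rfl hil
              · exact (h3 i hi).resolve_left fun h' => hil (congrArg _ h'))
          rw [GCFormula.sat_existsGe, GCFormula.sat_existsGe, Function.comp_apply,
            Function.comp_apply, Fin.ofNat_val_eq] at this
          simpa only [GCFormula.sat_update_comp_ofNat _ h2] using this
        have := le_antisymm ((hcard _).1 le_rfl) ((hcard _).2 le_rfl)
        simpa [Nat.card_eq_fintype_card, Fintype.card_subtype] using this)
    refine ⟨f, fun y φ h1 h2 h3 => ?_⟩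
    have := hf ⟨φ, h1, h2, h3⟩ y
    by_contra hcon
    by_cases hs : φ.Sat G (Function.update x l y ∘ Fin.ofNat k) <;> simp_all

theorem gcEquivalent_iff_exists_guardedGame {q : ℕ} (hk : 1 ≤ k) : GCEquivalent k q G H ↔
    ∃ f : V ≃ W, ∀ v, GuardedGame G H q (fun _ : Fin k => v) fun _ => f v := by
  constructor
  · rintro ⟨f, hf⟩
    have : NeZero k := ⟨by omega⟩
    refine ⟨f, fun v => ?_⟩
    -- Only one variable may be free, so a single pebble is in use and all others are stacked on it.
    refine SameFormulas.guardedGame (D := {0}) (x := fun _ => v) (x' := fun _ => f v)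
      (fun φ h1 h2 h3 => ?_) (fun _ => 0) fun _ => rfl
    have hsub : φ.free ⊆ φ.vars := by
      clear h1 h2 h3
      induction φ with
      | eq x y => exact subset_rfl
      | edge x y => exact subset_rfl
      | not φ ih => exact ih
      | and φ ψ ih₁ ih₂ => exact Finset.union_subset_union ih₁ ih₂
      | or φ ψ ih₁ ih₂ => exact Finset.union_subset_union ih₁ ih₂
      | imp φ ψ ih₁ ih₂ => exact Finset.union_subset_union ih₁ ih₂
      | existsGe t x y hxy ψ ih =>
        exact (Finset.erase_subset _ _).trans (Finset.union_subset_union subset_rfl ih)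
    refine hf v 0 φ ⟨?_, h1⟩ fun n hn => ?_
    · calc φ.vars.card ≤ (Finset.range k).card :=
            Finset.card_le_card fun n hn => Finset.mem_range.2 (h2 n hn)
        _ = k := Finset.card_range k
    · have := h3 ⟨n, h2 n (hsub hn)⟩ hn
      simpa [Fin.ext_iff] using this
  · rintro ⟨f, hf⟩
    refine ⟨f, fun v _ φ hφ _ => ?_⟩
    obtain ⟨ρ, hρ⟩ := φ.vars.exists_injOn_fin hφ.1 hk
    exact (hf v).sat_iff (fun _ _ => by simp) hφ.2 hρ (fun _ _ => rfl) fun _ _ => rfl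

end

/-! ### Rooted homomorphism counts -/

namespace LabelledGraph

variable {k : ℕ} {V : Type*}

instance (F : LabelledGraph k) : Finite F.V := F.finite

/-- The vertex carries some label. -/
def Labelled (F : LabelledGraph k) (v : F.V) : Prop :=
  ∃ l, F.lab l = some v

/-- The map `h` sends the labelled vertices to the prescribed roots `x` and preserves edges; if `R`
holds, then edges between labelled vertices are ignored. -/
def IsRootedHom (F : LabelledGraph k) (G : SimpleGraph V) (R : Prop) (x : Fin k → V)
    (h : F.V → V) : Prop :=
  (∀ l v, F.lab l = some v → h v = x l) ∧
    ∀ u v, F.graph.Adj u v → G.Adj (h u) (h v) ∨ R ∧ F.Labelled u ∧ F.Labelled v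

/-- The number of rooted homomorphisms. -/
noncomputable def homCount (F : LabelledGraph k) (G : SimpleGraph V) (R : Prop) (x : Fin k → V) :
    ℕ :=
  Nat.card {h : F.V → V // F.IsRootedHom G R x h}

theorem Isomorphic.refl (F : LabelledGraph k) : F.Isomorphic F :=
  ⟨SimpleGraph.Iso.refl, fun l => by cases h : F.lab l <;> simp⟩

theorem Isomorphic.homCount_eq {F F' : LabelledGraph k} (h : F.Isomorphic F') (G : SimpleGraph V)
    (R : Prop) (x : Fin k → V) : F.homCount G R x = F'.homCount G R x := by
  obtain ⟨e, he⟩ := h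
  have hlab : ∀ l v, F'.lab l = some (e v) ↔ F.lab l = some v := by
    intro l v
    rw [he l]
    cases F.lab l <;> simp
  have hlabelled : ∀ v, F'.Labelled (e v) ↔ F.Labelled v := fun v =>
    exists_congr fun l => hlab l v
  refine Nat.card_congr (Equiv.subtypeEquiv (Equiv.arrowCongr e.toEquiv (Equiv.refl V)) ?_)
  intro h
  have hval : ∀ v, (Equiv.arrowCongr e.toEquiv (Equiv.refl V)) h (e v) = h v := by
    intro v
    exact congrArg h (e.symm_apply_apply v)
  unfold IsRootedHom
  refine and_congr (forall_congr' fun l => ?_) ?_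
  · rw [← e.toEquiv.forall_congr_right]
    refine forall_congr' fun v => ?_
    change _ ↔ (F'.lab l = some (e v) → _ = _)
    rw [hlab]
    exact imp_congr_right fun _ => by rw [← hval v]; rfl
  · rw [← e.toEquiv.forall_congr_right]
    refine forall_congr' fun u => ?_
    rw [← e.toEquiv.forall_congr_right]
    refine forall_congr' fun v => ?_
    change _ ↔ (F'.graph.Adj (e u) (e v) → G.Adj (_) (_) ∨ R ∧ F'.Labelled (e u) ∧
      F'.Labelled (e v))
    rw [e.map_adj_iff, hlabelled, hlabelled, ← hval u, ← hval v]
    rfl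

section Remove

variable {F : LabelledGraph k} {l : Fin k} {v : F.V}

theorem remove_lab_eq_some {m : Fin k} {w : F.V} :
    (F.remove l).lab m = some w ↔ m ≠ l ∧ F.lab m = some w := by
  by_cases h : m = l
  · subst h; simp [remove]
  · simp [remove, h]

theorem isRootedHom_remove {G : SimpleGraph V} {R : Prop} {x : Fin k → V} {h : F.V → V} :
    (F.remove l).IsRootedHom G R x h ↔ (∀ m w, m ≠ l → F.lab m = some w → h w = x m) ∧
      ∀ u w, F.graph.Adj u w → G.Adj (h u) (h w) ∨
        R ∧ (∃ m, m ≠ l ∧ F.lab m = some u) ∧ ∃ m, m ≠ l ∧ F.lab m = some w := by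
  refine and_congr (forall_congr' fun m => forall_congr' fun w => ?_)
    (forall_congr' fun u => forall_congr' fun w => imp_congr_right fun _ =>
      or_congr_right (and_congr_right fun _ => and_congr (exists_congr fun m => ?_)
        (exists_congr fun m => ?_)))
  · exact (imp_congr_left remove_lab_eq_some).trans and_imp
  · exact remove_lab_eq_some
  · exact remove_lab_eq_some

variable (G : SimpleGraph V) (x : Fin k → V)

theorem homCount_eq_sum_card [Fintype V] (F : LabelledGraph k) (v : F.V) (R : Prop) : F.homCount G R x =
    ∑ y, Nat.card {h : F.V → V // F.IsRootedHom G R x h ∧ h v = y} := by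
  rw [homCount, ← Nat.card_congr (Equiv.sigmaFiberEquiv
    fun h : {h : F.V → V // F.IsRootedHom G R x h} => h.1 v), Nat.card_sigma]
  exact Finset.sum_congr rfl fun y _ => Nat.card_congr
    (Equiv.subtypeSubtypeEquivSubtypeInter (fun h => F.IsRootedHom G R x h) fun h => h v = y)

theorem homCount_remove [Fintype V] (hv : F.lab l = some v) : (F.remove l).homCount G False x =
    ∑ y, F.homCount G False (Function.update x l y) := by
  rw [homCount_eq_sum_card G x (F.remove l) v]
  refine Finset.sum_congr rfl fun y _ => Nat.card_congr (Equiv.subtypeEquivRight fun h => ?_)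
  refine (and_congr_left' isRootedHom_remove).trans ?_
  simp only [IsRootedHom, false_and, or_false]
  constructor
  · rintro ⟨⟨h1, h2⟩, h3⟩
    refine ⟨fun m w hm => ?_, h2⟩
    by_cases hml : m = l
    · subst hml
      rw [hv] at hm
      cases hm
      simpa using h3
    · simpa [hml] using h1 m w hml hm
  · rintro ⟨h1, h2⟩
    exact ⟨⟨fun m w hml hm => by simpa [hml] using h1 m w hm, h2⟩, by simpa using h1 l v hv⟩

/-- The vertex stays labelled, so its image remains prescribed by `m` and the same edges are
ignored: nothing is summed. -/
theorem homCount_remove_of_labelled (hv : F.lab l = some v) {m : Fin k} (hml : m ≠ l)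
    (hm : F.lab m = some v) : (F.remove l).homCount G True x =
    F.homCount G True (Function.update x l (x m)) := by
  have hlab : ∀ w, (∃ i, i ≠ l ∧ F.lab i = some w) ↔ F.Labelled w := by
    refine fun w => ⟨fun ⟨i, hi⟩ => ⟨i, hi.2⟩, fun ⟨i, hi⟩ => ?_⟩
    by_cases hil : i = l
    · subst hil
      rw [hv] at hi
      cases hi
      exact ⟨m, hml, hm⟩
    · exact ⟨i, hil, hi⟩
  refine Nat.card_congr (Equiv.subtypeEquivRight fun h => ?_)
  refine isRootedHom_remove.trans ?_
  simp only [hlab]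
  refine and_congr_left fun _ => ⟨fun h1 i w hi => ?_, fun h1 i w hil hi => ?_⟩
  · by_cases hil : i = l
    · subst hil
      rw [hv] at hi
      cases hi
      simpa using h1 m v hml hm
    · simpa [hil] using h1 i w hil hi
  · simpa [hil] using h1 i w hi

-- Here `v` becomes unlabelled: its image `y` is free, and the formerly ignored edges from `v` to
-- labelled vertices become conditions on `y`.
open Classical in
theorem homCount_remove_of_not_labelled [Fintype V] (hv : F.lab l = some v)
    (hl : ∀ m, m ≠ l → F.lab m ≠ some v) : (F.remove l).homCount G True x =
    ∑ y, if ∀ m w, m ≠ l → F.lab m = some w → F.graph.Adj v w → G.Adj y (x m) then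
      F.homCount G True (Function.update x l y) else 0 := by
  rw [homCount_eq_sum_card G x (F.remove l) v]
  refine Finset.sum_congr rfl fun y _ => ?_
  have hlab : ∀ w, (∃ i, i ≠ l ∧ F.lab i = some w) ↔ F.Labelled w ∧ w ≠ v := by
    refine fun w => ⟨fun ⟨i, hi⟩ => ⟨⟨i, hi.2⟩, ?_⟩, fun ⟨⟨i, hi⟩, hw⟩ => ⟨i, ?_, hi⟩⟩
    · rintro rfl
      exact hl i hi.1 hi.2
    · rintro rfl
      rw [hv] at hi
      exact hw (Option.some.inj hi).symm
  have key : ∀ h : F.V → V, ((F.remove l).IsRootedHom G True x h ∧ h v = y) ↔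
      F.IsRootedHom G True (Function.update x l y) h ∧
        ∀ m w, m ≠ l → F.lab m = some w → F.graph.Adj v w → G.Adj y (x m) := by
    intro h
    refine (and_congr_left' isRootedHom_remove).trans ?_
    simp only [IsRootedHom, hlab, true_and]
    constructor
    · rintro ⟨⟨h1, h2⟩, rfl⟩
      refine ⟨⟨fun m w hm => ?_, fun a b hab => ?_⟩, fun m w hml hm hvw => ?_⟩
      · by_cases hml : m = l
        · subst hml
          rw [hv] at hm
          cases hm
          simp
        · simpa [hml] using h1 m w hml hm
      · exact (h2 a b hab).imp_right fun h => ⟨h.1.1, h.2.1⟩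
      · rw [← h1 m w hml hm]
        exact (h2 v w hvw).resolve_right fun h => h.1.2 rfl
    · rintro ⟨⟨h1, h2⟩, h3⟩
      have hy : h v = y := by simpa using h1 l v hv
      have hguard : ∀ w, F.Labelled w → F.graph.Adj v w → G.Adj (h v) (h w) := by
        rintro w ⟨m, hm⟩ hvw
        have hml : m ≠ l := by
          rintro rfl
          rw [hv] at hm
          exact hvw.ne (Option.some.inj hm)
        have := h1 m w hm
        rw [Function.update_of_ne hml] at this
        rw [this, hy]
        exact h3 m w hml hm hvw
      refine ⟨⟨fun m w hml hm => by simpa [hml] using h1 m w hm, fun a b hab => ?_⟩, hy⟩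
      rcases h2 a b hab with h' | ⟨ha, hb⟩
      · exact Or.inl h'
      · by_cases hav : a = v
        · subst hav
          exact Or.inl (hguard b hb hab)
        · by_cases hbv : b = v
          · subst hbv
            exact Or.inl (hguard a ha hab.symm).symm
          · exact Or.inr ⟨⟨ha, hav⟩, hb, hbv⟩
  split_ifs with hC
  · exact Nat.card_congr (Equiv.subtypeEquivRight fun h => (key h).trans (and_iff_left hC))
  · exact @Nat.card_of_isEmpty _ ⟨fun h => hC ((key h.1).1 h.2).2⟩

end Remove

section Product

variable {n : ℕ} (F : Fin n → LabelledGraph k)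

theorem exists_of_product_lab_eq_some {l : Fin k} {a : (product F).V}
    (h : (product F).lab l = some a) :
    ∃ i v, (F i).lab l = some v ∧ a = Quot.mk (Glue F) ⟨i, v⟩ := by
  simp only [product] at h
  split_ifs at h with hx
  exact ⟨hx.choose.1, hx.choose.2, hx.choose_spec, (Option.some.inj h).symm⟩

theorem product_labelled_mk {i : Fin n} {v : (F i).V} :
    (product F).Labelled (Quot.mk (Glue F) ⟨i, v⟩) ↔ (F i).Labelled v := by
  refine ⟨fun ⟨l, hl⟩ => ?_, fun ⟨l, hl⟩ => ⟨l, product_lab_of_eq_some F hl⟩⟩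
  obtain ⟨j, w, hw, h⟩ := exists_of_product_lab_eq_some F hl
  have hlift : ∀ x y, Glue F x y → (F x.1).Labelled x.2 = (F y.1).Labelled y.2 :=
    fun x y ⟨l, h1, h2⟩ => propext ⟨fun _ => ⟨l, h2⟩, fun _ => ⟨l, h1⟩⟩
  have := congrArg (Quot.lift (fun x : Σ i, (F i).V => (F x.1).Labelled x.2) hlift) h
  exact this.mpr ⟨l, hw⟩

-- Gluing only ever relates labelled vertices, so an unlabelled vertex is alone in its class.
open Classical in
theorem eq_or_labelled_of_mk_eq {i : Fin n} {u v : (F i).V}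
    (h : Quot.mk (Glue F) ⟨i, u⟩ = Quot.mk (Glue F) ⟨i, v⟩) :
    u = v ∨ (F i).Labelled u ∧ (F i).Labelled v := by
  have hlift : ∀ x y, Glue F x y → (if (F x.1).Labelled x.2 then none else some x) =
      if (F y.1).Labelled y.2 then none else some y := by
    rintro x y ⟨l, h1, h2⟩
    rw [if_pos ⟨l, h1⟩, if_pos ⟨l, h2⟩]
  have := congrArg (Quot.lift (fun x : Σ i, (F i).V =>
    if (F x.1).Labelled x.2 then none else some x) hlift) h
  simp only at this
  split_ifs at this with h1 h2
  · exact Or.inr ⟨h1, h2⟩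
  · left
    simpa using this

/-- Rooted homomorphisms from a product are families of rooted homomorphisms from the factors,
provided that the suppressed loops do not matter. -/
theorem homCount_product (G : SimpleGraph V) {R : Prop} (x : Fin k → V)
    (hR : R ∨ ∀ i u v, (F i).graph.Adj u v →
      Quot.mk (Glue F) ⟨i, u⟩ ≠ Quot.mk (Glue F) ⟨i, v⟩) :
    (product F).homCount G R x = ∏ i, (F i).homCount G R x := by
  simp only [homCount]
  rw [← Nat.card_pi]
  have hlab : ∀ {h : ∀ i, (F i).V → V}, (∀ i, (F i).IsRootedHom G R x (h i)) →
      ∀ a b, Glue F a b → h a.1 a.2 = h b.1 b.2 := by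
    rintro h hh a b ⟨l, h1, h2⟩
    rw [(hh a.1).1 l a.2 h1, (hh b.1).1 l b.2 h2]
  refine Nat.card_congr
    { toFun := fun h i => ⟨fun v => h.1 (Quot.mk (Glue F) ⟨i, v⟩), ?_, ?_⟩
      invFun := fun h => ⟨Quot.lift (fun a => (h a.1).1 a.2) (hlab fun i => (h i).2), ?_, ?_⟩
      left_inv := fun h => ?_
      right_inv := fun h => ?_ }
  · exact fun l v hl => h.2.1 l _ (product_lab_of_eq_some F hl)
  · intro u v huv
    by_cases hne : Quot.mk (Glue F) ⟨i, u⟩ = Quot.mk (Glue F) ⟨i, v⟩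
    · rcases hR with hR | hR
      -- The edge has become a loop; both ends are labelled, so it is ignored in the factor too.
      · exact Or.inr ⟨hR, (eq_or_labelled_of_mk_eq F hne).resolve_left huv.ne⟩
      · exact absurd hne (hR i u v huv)
    · have := h.2.2 (Quot.mk (Glue F) ⟨i, u⟩) (Quot.mk (Glue F) ⟨i, v⟩)
        ((SimpleGraph.fromRel_adj _ _ _).2 ⟨hne, Or.inl ⟨i, u, v, huv, rfl, rfl⟩⟩)
      rwa [product_labelled_mk, product_labelled_mk] at this
  · intro l a ha
    obtain ⟨i, v, hv, rfl⟩ := exists_of_product_lab_eq_some F ha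
    exact (h i).2.1 l v hv
  · intro a b hab
    obtain ⟨-, ⟨i, u, v, huv, rfl, rfl⟩ | ⟨i, u, v, huv, rfl, rfl⟩⟩ :=
      (SimpleGraph.fromRel_adj _ _ _).1 hab
    · rw [product_labelled_mk, product_labelled_mk]
      exact (h i).2.2 u v huv
    · rw [product_labelled_mk, product_labelled_mk]
      exact (h i).2.2 v u huv.symm
  · ext a
    induction a using Quot.ind
    rfl
  · rfl

end Product

open Classical in
theorem FullyLabelled.homCount_eq {F : LabelledGraph k} (hF : F.FullyLabelled)
    (G : SimpleGraph V) (x : Fin k → V) : F.homCount G True x =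
      if ∀ l m v, F.lab l = some v → F.lab m = some v → x l = x m then 1 else 0 := by
  choose lb hlb using hF
  split_ifs with hx
  · refine Nat.card_eq_one_iff_unique.2 ⟨⟨fun h h' => ?_⟩, ⟨fun v => x (lb v), fun l v hl => ?_,
      fun u v _ => Or.inr ⟨trivial, ⟨_, hlb u⟩, _, hlb v⟩⟩⟩
    · ext v
      rw [h.2.1 _ v (hlb v), h'.2.1 _ v (hlb v)]
    · exact hx _ _ v (hlb v) hl
  · have : IsEmpty {h : F.V → V // F.IsRootedHom G True x h} :=
      ⟨fun h => hx fun l m v hl hm => (h.2.1 l v hl).symm.trans (h.2.1 m v hm)⟩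
    exact Nat.card_of_isEmpty

/-- A graph with a single labelled vertex has as many homomorphisms as rooted homomorphisms, summed
over all roots. -/
theorem SingleLabelledVertex.card_hom [Fintype V] {F : LabelledGraph k}
    (hF : F.SingleLabelledVertex) (G : SimpleGraph V) (R : Prop) :
    Nat.card (F.graph →g G) = ∑ v, F.homCount G R fun _ => v := by
  obtain ⟨r, ⟨l, hl⟩, hr⟩ := hF
  simp only [homCount]
  rw [← Nat.card_sigma]
  refine Nat.card_congr
    { toFun := fun h => ⟨h r, h, ?_, ?_⟩
      invFun := fun h => ⟨h.2.1, ?_⟩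
      left_inv := fun h => rfl
      right_inv := ?_ }
  · intro m v hm
    rw [hr v ⟨m, hm⟩]
  · exact fun u v huv => Or.inl (h.map_adj huv)
  · intro u v huv
    -- An edge between labelled vertices would be a loop at `r`, so `R` has no effect.
    refine (h.2.2.2 u v huv).resolve_right fun h' => huv.ne ?_
    rw [hr u h'.2.1, hr v h'.2.2]
  · rintro ⟨v, h, h1, h2⟩
    obtain rfl : h r = v := h1 l r hl
    rfl

end LabelledGraph

/-! ### From the game to homomorphism counts -/

theorem Fintype.sum_subtype_eq_of_eq_zero {V : Type*} [Fintype V] (p : V → Prop)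
    [Fintype {y // p y}] (φ : V → ℕ) (h : ∀ y, ¬ p y → φ y = 0) :
    ∑ y, φ y = ∑ y : {y // p y}, φ y := by
  classical
  rw [← Finset.sum_subtype (Finset.univ.filter p) (by simp) φ]
  exact (Finset.sum_subset (Finset.filter_subset _ _) fun y _ hy => h y (by simpa using hy)).symm

section

variable {k : ℕ} {V W : Type*} [Finite V] [Finite W] {G : SimpleGraph V} {H : SimpleGraph W}

/-- Winning positions admit equally many rooted homomorphisms, if edges between labelled vertices
are ignored. -/
theorem GuardedGame.homCount_eq {F : LabelledGraph k} (t : ConstructionTree k F) (ht : t.Guarded)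
    {q : ℕ} (hq : t.eliminationDepth ≤ q) {x : Fin k → V} {x' : Fin k → W}
    (h : GuardedGame G H q x x') (hx : SameEq x x') :
    F.homCount G True x = F.homCount H True x' := by
  classical
  have := Fintype.ofFinite V
  have := Fintype.ofFinite W
  induction t generalizing q x x' with
  | leaf F hF =>
    rw [hF.homCount_eq, hF.homCount_eq]
    simp only [hx _ _]
  | product F n hn F' hF t ih =>
    rw [hF.homCount_eq, hF.homCount_eq, LabelledGraph.homCount_product _ _ _ (Or.inl trivial),
      LabelledGraph.homCount_product _ _ _ (Or.inl trivial)]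
    refine Finset.prod_congr rfl fun i _ => ih i (ht i) (le_trans ?_ hq) h hx
    exact Finset.le_sup (f := fun i => (t i).eliminationDepth) (Finset.mem_univ i)
  | elimination F F' l hF t ih =>
    obtain ⟨⟨v, w, m, hv, hm, hvw⟩, ht⟩ := ht
    simp only [ConstructionTree.eliminationDepth] at hq
    obtain ⟨q, rfl⟩ : ∃ r, q = r + 1 := ⟨q - 1, by omega⟩
    have hq : t.eliminationDepth ≤ q := by omega
    have hml : m ≠ l := by
      rintro rfl
      rw [hv] at hm
      exact hvw.ne (Option.some.inj hm)
    rw [hF.homCount_eq, hF.homCount_eq]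
    by_cases hl : ∃ m, m ≠ l ∧ F'.lab m = some v
    · obtain ⟨i, hil, hi⟩ := hl
      rw [LabelledGraph.homCount_remove_of_labelled _ _ hv hil hi,
        LabelledGraph.homCount_remove_of_labelled _ _ hv hil hi]
      refine ih ht hq (h.of_succ.update_self l i) fun a b => ?_
      by_cases ha : a = l <;> by_cases hb : b = l <;> simp [ha, hb, hx _ _]
    · have hl : ∀ m, m ≠ l → F'.lab m ≠ some v := fun m h1 h2 => hl ⟨m, h1, h2⟩
      obtain ⟨f, hf⟩ := h.forth hx hml
      -- The labelled neighbour `w` forces `y` to be adjacent to `x m`, so both sums live on the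
      -- neighbourhoods matched by `f`.
      rw [LabelledGraph.homCount_remove_of_not_labelled _ _ hv hl,
        LabelledGraph.homCount_remove_of_not_labelled _ _ hv hl,
        Fintype.sum_subtype_eq_of_eq_zero (fun y => G.Adj (x m) y),
        Fintype.sum_subtype_eq_of_eq_zero (fun y => H.Adj (x' m) y)]
      · refine Fintype.sum_equiv f _ _ fun y => ?_
        have hC : (∀ i w, i ≠ l → F'.lab i = some w → F'.graph.Adj v w → G.Adj y (x i)) ↔
            ∀ i w, i ≠ l → F'.lab i = some w → F'.graph.Adj v w → H.Adj (f y) (x' i) := by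
          refine forall_congr' fun i => forall_congr' fun w => imp_congr_right fun hil => ?_
          have := (hf y).1.adj l i
          simp only [Function.update_self, Function.update_of_ne hil] at this
          rw [this]
        rw [ih ht hq (hf y).1 (hf y).2]
        simp only [hC]
      · exact fun y hy => if_neg fun hC => hy (hC m w hml hm hvw).symm
      · exact fun y hy => if_neg fun hC => hy (hC m w hml hm hvw).symm

end

/-! ### From homomorphism counts to the game, via injective labellings -/

namespace LabelledGraph

variable {k : ℕ} {V : Type*}

/-- No vertex carries two labels. -/
def InjLab (F : LabelledGraph k) : Prop :=
  ∀ l m v, F.lab l = some v → F.lab m = some v → l = m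

/-- In a product of graphs with injective labellings, vertices of a factor are not identified, and
the labelling is injective. -/
theorem InjLab.product_mk {n : ℕ} {F : Fin n → LabelledGraph k} (hF : ∀ i, (F i).InjLab) :
    (∀ i (u v : (F i).V), Quot.mk (Glue F) ⟨i, u⟩ = Quot.mk (Glue F) ⟨i, v⟩ → u = v) ∧
      (product F).InjLab := by
  -- With injective labellings, glued vertices carry exactly the same single label, so the set of
  -- labels is an invariant of the class.
  have hlift : ∀ a b, Glue F a b → (fun l => (F a.1).lab l = some a.2) =
      fun l => (F b.1).lab l = some b.2 := by
    rintro a b ⟨l, ha, hb⟩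
    ext m
    exact ⟨fun hm => hF _ _ _ _ ha hm ▸ hb, fun hm => hF _ _ _ _ hb hm ▸ ha⟩
  have hlab : ∀ {a b}, Quot.mk (Glue F) a = Quot.mk (Glue F) b →
      ∀ l, (F a.1).lab l = some a.2 → (F b.1).lab l = some b.2 := fun hab l ha =>
    (congrFun (congrArg (Quot.lift (fun (a : Σ i, (F i).V) l => (F a.1).lab l = some a.2) hlift)
      hab) l).mp ha
  refine ⟨fun i u v huv => ?_, fun l m a hl hm => ?_⟩
  · rcases eq_or_labelled_of_mk_eq F huv with h | ⟨⟨l, hl⟩, -⟩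
    · exact h
    · exact Option.some.inj (hl.symm.trans (hlab huv l hl))
  · obtain ⟨i, u, hu, rfl⟩ := exists_of_product_lab_eq_some F hl
    obtain ⟨j, w, hw, h⟩ := exists_of_product_lab_eq_some F hm
    exact hF i _ _ _ hu (hlab h.symm m hw)

/-- The product of two labelled graphs. -/
noncomputable def mul (F₁ F₂ : LabelledGraph k) : LabelledGraph k :=
  product fun i : Fin 2 => if i = 0 then F₁ else F₂

section Mul

variable {F₁ F₂ : LabelledGraph k}

theorem InjLab.ite (h₁ : F₁.InjLab) (h₂ : F₂.InjLab) (i : Fin 2) :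
    (if i = 0 then F₁ else F₂).InjLab := by
  split_ifs <;> assumption

theorem InjLab.mul (h₁ : F₁.InjLab) (h₂ : F₂.InjLab) : (F₁.mul F₂).InjLab :=
  (InjLab.product_mk (h₁.ite h₂)).2

theorem InjLab.homCount_mul (h₁ : F₁.InjLab) (h₂ : F₂.InjLab) (G : SimpleGraph V)
    (x : Fin k → V) : (F₁.mul F₂).homCount G False x =
      F₁.homCount G False x * F₂.homCount G False x := by
  rw [LabelledGraph.mul, homCount_product _ _ _ (Or.inr fun i u v huv huv' =>
    huv.ne ((InjLab.product_mk (h₁.ite h₂)).1 i u v huv'))]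
  simp [Fin.prod_univ_two]

theorem mul_lab_eq_some {l : Fin k} {a : (F₁.mul F₂).V} (h : (F₁.mul F₂).lab l = some a) :
    (∃ v, F₁.lab l = some v) ∨ ∃ v, F₂.lab l = some v := by
  obtain ⟨i, v, hv, -⟩ := exists_of_product_lab_eq_some _ h
  by_cases hi : i = 0
  · subst hi
    exact Or.inl ⟨v, hv⟩
  · obtain rfl : i = 1 := by omega
    exact Or.inr ⟨v, hv⟩

theorem _root_.GuardedL.mul {q : ℕ} (h₁ : GuardedL k q F₁) (h₂ : GuardedL k q F₂) :
    GuardedL k q (F₁.mul F₂) := by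
  have h : ∀ i : Fin 2, GuardedL k q (if i = 0 then F₁ else F₂) := by
    intro i
    split_ifs <;> assumption
  choose t ht hq using h
  exact ⟨.product _ 2 le_rfl _ (Isomorphic.refl _) t, ht, Finset.sup_le fun i _ => hq i⟩

end Mul

theorem _root_.GuardedL.of_fullyLabelled {q : ℕ} {F : LabelledGraph k} (h : F.FullyLabelled) :
    GuardedL k q F :=
  ⟨.leaf F h, trivial, Nat.zero_le _⟩

theorem _root_.GuardedL.remove {q : ℕ} {F : LabelledGraph k} {l : Fin k} (h : GuardedL k q F)
    (hl : F.HasLabelledNeighbour l) : GuardedL k (q + 1) (F.remove l) := by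
  obtain ⟨t, ht, hq⟩ := h
  exact ⟨.elimination _ F l (Isomorphic.refl _) t, ⟨hl, ht⟩, Nat.succ_le_succ hq⟩

/-- The empty graph. -/
def empty (k : ℕ) : LabelledGraph k where
  V := Empty
  finite := inferInstance
  graph := ⊥
  lab _ := none

theorem homCount_empty (G : SimpleGraph V) (x : Fin k → V) : (empty k).homCount G False x = 1 := by
  refine Nat.card_eq_one_iff_unique.2 ⟨⟨fun h h' => Subtype.ext (funext fun v => v.elim)⟩,
    ⟨fun v => v.elim, fun _ v => v.elim, fun u => u.elim⟩⟩

/-- A single vertex with label `l`. -/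
def point (l : Fin k) : LabelledGraph k where
  V := Unit
  finite := inferInstance
  graph := ⊥
  lab m := if m = l then some () else none

theorem point_lab_eq_some {l m : Fin k} {v : Unit} : (point l).lab m = some v ↔ m = l := by
  by_cases h : m = l <;> simp [point, h]

theorem homCount_point (l : Fin k) (G : SimpleGraph V) (x : Fin k → V) :
    (point l).homCount G False x = 1 := by
  refine Nat.card_eq_one_iff_unique.2 ⟨⟨fun h h' => Subtype.ext (funext fun v => ?_)⟩,
    ⟨fun _ => x l, fun m v hm => by rw [point_lab_eq_some.1 hm], fun u v huv => huv.elim⟩⟩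
  rw [h.2.1 l v (point_lab_eq_some.2 rfl), h'.2.1 l v (point_lab_eq_some.2 rfl)]

/-- An edge whose ends carry the labels `g` and `l`. -/
def edge (g l : Fin k) : LabelledGraph k where
  V := Bool
  finite := inferInstance
  graph := ⊤
  lab m := if m = l then some true else if m = g then some false else none

section Edge

variable {g l : Fin k}

theorem edge_lab_eq_some (hgl : g ≠ l) {m : Fin k} {v : Bool} :
    (edge g l).lab m = some v ↔ m = bif v then l else g := by
  by_cases h : m = l
  · subst h
    cases v <;> simp [edge, hgl.symm]
  · by_cases h' : m = g
    · subst h'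
      cases v <;> simp [edge, h]
    · cases v <;> simp [edge, h, h']

theorem edge_injLab (hgl : g ≠ l) : (edge g l).InjLab := fun _ _ _ ha hb =>
  ((edge_lab_eq_some hgl).1 ha).trans ((edge_lab_eq_some hgl).1 hb).symm

theorem edge_fullyLabelled (hgl : g ≠ l) : (edge g l).FullyLabelled := fun _ =>
  ⟨_, (edge_lab_eq_some hgl).2 rfl⟩

open Classical in
theorem homCount_edge (hgl : g ≠ l) (G : SimpleGraph V) (x : Fin k → V) :
    (edge g l).homCount G False x = if G.Adj (x g) (x l) then 1 else 0 := by
  have hval : ∀ h : {h : Bool → V // (edge g l).IsRootedHom G False x h}, ∀ v,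
      h.1 v = x (bif v then l else g) := fun h v => h.2.1 _ v ((edge_lab_eq_some hgl).2 rfl)
  split_ifs with hadj
  · refine Nat.card_eq_one_iff_unique.2 ⟨⟨fun h h' => Subtype.ext (funext fun v => ?_)⟩,
      ⟨fun v => x (bif v then l else g), fun m v hm => ?_, fun u v huv => Or.inl ?_⟩⟩
    · exact (hval h v).trans (hval h' v).symm
    · exact congrArg x ((edge_lab_eq_some hgl).1 hm).symm
    · have huv : u ≠ v := huv
      cases u <;> cases v
      exacts [absurd rfl huv, hadj, hadj.symm, absurd rfl huv]
  · refine @Nat.card_of_isEmpty _ ⟨fun h => hadj ?_⟩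
    have := (h.2.2 false true Bool.false_ne_true).resolve_right fun h => h.1
    have h0 : h.1 false = x g := hval h false
    have h1 : h.1 true = x l := hval h true
    rwa [h0, h1] at this

theorem mul_edge_hasLabelledNeighbour (hgl : g ≠ l) {F : LabelledGraph k} (hF : F.InjLab) :
    (F.mul (edge g l)).HasLabelledNeighbour l := by
  let Fs : Fin 2 → LabelledGraph k := fun i => if i = 0 then F else edge g l
  have hFs := hF.ite (edge_injLab hgl)
  refine ⟨Quot.mk (Glue Fs) ⟨1, true⟩, Quot.mk (Glue Fs) ⟨1, false⟩, g,
    product_lab_of_eq_some Fs ((edge_lab_eq_some hgl).2 rfl),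
    product_lab_of_eq_some Fs ((edge_lab_eq_some hgl).2 rfl),
    (SimpleGraph.fromRel_adj _ _ _).2 ⟨fun h => ?_, Or.inl ⟨1, true, false, ?_, rfl, rfl⟩⟩⟩
  · exact Bool.false_ne_true ((InjLab.product_mk hFs).1 1 true false h).symm
  · change (⊤ : SimpleGraph Bool).Adj true false
    simp

end Edge

end LabelledGraph

section

variable {k : ℕ} {V W : Type*} {G : SimpleGraph V} {H : SimpleGraph W}

open LabelledGraph

/-- Agreement of the rooted homomorphism counts from all injectively labelled graphs in
`GuardedL k q` with labels in `D`. -/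
def SameHomCounts (G : SimpleGraph V) (H : SimpleGraph W) (q : ℕ) (D : Set (Fin k))
    (x : Fin k → V) (x' : Fin k → W) : Prop :=
  ∀ F : LabelledGraph k, GuardedL k q F → F.InjLab → (∀ l v, F.lab l = some v → l ∈ D) →
    F.homCount G False x = F.homCount H False x'

theorem SameHomCounts.exists_equiv {A B : Type*} [Fintype A] [Fintype B] (q : ℕ) (D : Set (Fin k))
    (x : A → Fin k → V) (x' : B → Fin k → W)
    (sum : ∀ F : LabelledGraph k, GuardedL k q F → F.InjLab → (∀ l v, F.lab l = some v → l ∈ D) →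
      ∑ y, F.homCount G False (x y) = ∑ z, F.homCount H False (x' z)) :
    ∃ f : A ≃ B, ∀ y, SameHomCounts G H q D (x y) (x' (f y)) := by
  let Φ := {F : LabelledGraph k // GuardedL k q F ∧ F.InjLab ∧ ∀ l v, F.lab l = some v → l ∈ D}
  obtain ⟨f, hf⟩ := exists_equiv_of_sum_eq (fun (F : Φ) y => F.1.homCount G False (x y))
    (fun (F : Φ) z => F.1.homCount H False (x' z))
    ⟨⟨LabelledGraph.empty k, .of_fullyLabelled fun v => v.elim, fun _ _ v => v.elim,
      fun _ v => v.elim⟩, fun y => homCount_empty _ _, fun y => homCount_empty _ _⟩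
    (by
      rintro ⟨F₁, h₁, i₁, l₁⟩ ⟨F₂, h₂, i₂, l₂⟩
      exact ⟨⟨F₁.mul F₂, h₁.mul h₂, i₁.mul i₂, fun l v hl => (mul_lab_eq_some hl).elim
        (fun ⟨v, hv⟩ => l₁ l v hv) fun ⟨v, hv⟩ => l₂ l v hv⟩,
        fun y => i₁.homCount_mul i₂ _ _, fun y => i₁.homCount_mul i₂ _ _⟩)
    (fun F => sum F.1 F.2.1 F.2.2.1 F.2.2.2)
  exact ⟨f, fun y F h1 h2 h3 => hf ⟨F, h1, h2, h3⟩ y⟩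

/-- The attached edge contributes the indicator of adjacency to `x g`, and removing `l` sums over
its root. The same edge makes the elimination guarded. -/
theorem LabelledGraph.InjLab.homCount_mul_edge_remove [Fintype V] {F : LabelledGraph k}
    (hF : F.InjLab) {g l : Fin k} (hgl : g ≠ l) (x : Fin k → V) [Fintype {y // G.Adj (x g) y}] :
    ((F.mul (edge g l)).remove l).homCount G False x =
      ∑ y : {y // G.Adj (x g) y}, F.homCount G False (Function.update x l y) := by
  classical
  obtain ⟨v, -, -, hv, -⟩ := mul_edge_hasLabelledNeighbour hgl hF
  rw [homCount_remove _ _ hv, Fintype.sum_subtype_eq_of_eq_zero (fun y => G.Adj (x g) y)]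
  · refine Finset.sum_congr rfl fun y _ => ?_
    rw [hF.homCount_mul (edge_injLab hgl), homCount_edge hgl]
    simp [hgl, y.2]
  · intro y hy
    rw [hF.homCount_mul (edge_injLab hgl), homCount_edge hgl]
    simp [hgl, hy]

theorem SameHomCounts.guardedGame [Finite V] [Finite W] {q : ℕ} {D : Set (Fin k)} {x : Fin k → V} {x' : Fin k → W}
    (h : SameHomCounts G H q D x x') (τ : Fin k → Fin k) (hτ : ∀ i, τ i ∈ D) :
    GuardedGame G H q (x ∘ τ) (x' ∘ τ) := by
  classical
  have := Fintype.ofFinite V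
  have := Fintype.ofFinite W
  refine GuardedGame.of_family (SameHomCounts G H) ?_ ?_ h τ hτ
  · intro q D x x' h i hi j hj
    by_cases hij : i = j
    · subst hij; simp
    · have := h (edge i j) (.of_fullyLabelled (edge_fullyLabelled hij)) (edge_injLab hij)
        fun l v hl => by
          rw [(edge_lab_eq_some hij).1 hl]
          cases v <;> assumption
      rw [homCount_edge hij, homCount_edge hij] at this
      split_ifs at this <;> simp_all
  · intro q D x x' h g hg l hgl
    refine SameHomCounts.exists_equiv q (insert l D)
      (fun y : {y // G.Adj (x g) y} => Function.update x l (y : V))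
      (fun z : {z // H.Adj (x' g) z} => Function.update x' l (z : W)) fun F h1 h2 h3 => ?_
    rw [← h2.homCount_mul_edge_remove hgl, ← h2.homCount_mul_edge_remove hgl]
    refine h _ ((h1.mul (.of_fullyLabelled (edge_fullyLabelled hgl))).remove
      (mul_edge_hasLabelledNeighbour hgl h2)) (fun a b v ha hb => ?_) fun m v hm => ?_
    · exact (h2.mul (edge_injLab hgl)) a b v (remove_lab_eq_some.1 ha).2
        (remove_lab_eq_some.1 hb).2
    · obtain ⟨hml, hm⟩ := remove_lab_eq_some.1 hm
      rcases mul_lab_eq_some hm with ⟨w, hw⟩ | ⟨w, hw⟩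
      · exact (h3 m w hw).resolve_left hml
      · have := (edge_lab_eq_some hgl).1 hw
        cases w
        · exact this ▸ hg
        · exact absurd this hml

theorem HomIndistinguishable.exists_guardedGame [Finite V] [Finite W] [NeZero k] {q : ℕ}
    (h : HomIndistinguishable (GuardedT k q) G H) :
    ∃ f : V ≃ W, ∀ v, GuardedGame G H q (fun _ : Fin k => v) fun _ => f v := by
  have := Fintype.ofFinite V
  have := Fintype.ofFinite W
  obtain ⟨f, hf⟩ := SameHomCounts.exists_equiv (G := G) (H := H) q {(0 : Fin k)}
    (fun v _ => v) (fun w _ => w) fun F h1 h2 h3 => by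
      have hpt : (point (0 : Fin k)).InjLab := fun a b v ha hb =>
        (point_lab_eq_some.1 ha).trans (point_lab_eq_some.1 hb).symm
      -- `F` may carry no label at all; gluing on a point labelled `0` ensures one labelled vertex
      -- and leaves the rooted counts unchanged.
      have hL : (F.mul (point 0)).SingleLabelledVertex := by
        let Fs : Fin 2 → LabelledGraph k := fun i => if i = 0 then F else point 0
        have h0 : (F.mul (point 0)).lab 0 = some (Quot.mk (Glue Fs) ⟨1, ()⟩) :=
          product_lab_of_eq_some Fs (point_lab_eq_some.2 rfl)
        refine ⟨_, ⟨0, h0⟩, fun a ⟨l, hl⟩ => ?_⟩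
        have : l = 0 := (mul_lab_eq_some hl).elim (fun ⟨v, hv⟩ => h3 l v hv)
          fun ⟨v, hv⟩ => point_lab_eq_some.1 hv
        subst this
        exact Option.some.inj (hl.symm.trans h0)
      have := h (F.mul (point 0)).V (F.mul (point 0)).graph ⟨_,
        h1.mul (.of_fullyLabelled fun v => ⟨0, point_lab_eq_some.2 rfl⟩), hL,
        ⟨SimpleGraph.Iso.refl⟩⟩
      rw [hL.card_hom _ False, hL.card_hom _ False] at this
      simpa only [h2.homCount_mul hpt, homCount_point, mul_one] using this
  exact ⟨f, fun v => (hf v).guardedGame (fun _ => 0) fun _ => rfl⟩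

theorem HomIndistinguishable.of_guardedGame [Finite V] [Finite W] {q : ℕ} (f : V ≃ W)
    (hf : ∀ v, GuardedGame G H q (fun _ : Fin k => v) fun _ => f v) :
    HomIndistinguishable (GuardedT k q) G H := by
  have := Fintype.ofFinite V
  have := Fintype.ofFinite W
  rintro X _ F ⟨L, ⟨t, ht, hq⟩, hL, ⟨e⟩⟩
  have hV : Nat.card (F →g G) = Nat.card (L.graph →g G) := Nat.card_congr
    ⟨fun h => h.comp e.symm.toHom, fun h => h.comp e.toHom, fun h => by ext; simp,
      fun h => by ext; simp⟩
  have hW : Nat.card (F →g H) = Nat.card (L.graph →g H) := Nat.card_congr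
    ⟨fun h => h.comp e.symm.toHom, fun h => h.comp e.toHom, fun h => by ext; simp,
      fun h => by ext; simp⟩
  rw [hV, hW, hL.card_hom _ True, hL.card_hom _ True]
  exact Fintype.sum_equiv f _ _ fun v => (hf v).homCount_eq t ht hq fun _ _ => by simp

end

theorem mainTheorem5 (k q : ℕ) (hk : 1 ≤ k) (hq : 1 ≤ q)
    {V W : Type*} [Finite V] [Finite W] (G : SimpleGraph V) (H : SimpleGraph W) :
    GCEquivalent k q G H ↔ HomIndistinguishable (GuardedT k q) G H := by
  have : NeZero k := ⟨by omega⟩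
  rw [gcEquivalent_iff_exists_guardedGame hk]
  exact ⟨fun ⟨f, hf⟩ => .of_guardedGame f hf, fun h => h.exists_guardedGame⟩
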